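/- Let $\dot x=f(x,u)$ be a smooth ($C^\infty$) control system with $n_x$ states and $n_u$ inputs on an open set $\Omega\subseteq\mathbb R^{n_x}\times\mathbb R^{n_u}$ (local coordinates). **1-flatness.** On the jet space with coordinates $(x,u,\dot u,\ddot u,\dots)$ (product topology) let $\frac{d}{dt}=f(x,u)\,\partial_x+\dot u\,\partial_u+\ddot u\,\partial_{\dot u}+\cdots$. A smooth map $y=y(x,u)$ with $n_u$ components is a *flat output* near a jet $\xi_0=(x_0,u_0,\dot u_0,\ddot u_0,\dots)$ if on a neighbourhood of $\xi_0$ in the jet space (i) the components of $y$ are differentially independent, i.e. the differentials of all the functions $\frac{d^k}{dt^k}y^i$ ($k\ge 0$, $1\le i\le n_u$) are linearly independent at every point, and (ii) $(x,u)=F(y,\dot y,\dots,y^{(r)})$ for some $r$ and some smooth map $F$ defined on an open set. The system is *1-flat* near $\xi_0$ if it has such a flat output depending on $x$ and $u$ only. **Implicit triangular form.** Let $m=n_b+1$ and let $z=(z^1,\dots,z^m)$ be coordinates with blocks $z^i=(y^i,\hat z^i)$, $n_{z^i}=n_{y^i}+n_{\hat z^i}$, where $z^1=y^1$, $z^m=\hat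 z^m$ and any of the sub-blocks may be empty. The equations $\Xi^i_e=0$, $i=1,\dots,n_b$, with $$\Xi^i_e=\sum_{k=1}^{i}a^i_k\,\dot z^k-b^i ,$$ are in implicit triangular form at a point $(z_0,\dot z_0)$ if $\dim\Xi^i_e=\dim\hat z^{i+1}$, the entries of $a^i_k$ and $b^i$ are smooth functions of $(z^1,\dots,z^i,\hat z^{i+1})$ only, and the square Jacobian matrices $[\partial_{\hat z^{i+1}}\Xi^i_e]$ are regular at $(z_0,\dot z_0)$ for all $i=1,\dots,n_b$. **Proposition.** Let $\xi_0=(x_0,u_0,\dot u_0,\ddot u_0,\dots)$ be a jet with $(x_0,u_0)\in\Omega$. Suppose there is a diffeomorphism $(x,u)=\varphi(z^1,\dots,z^m)$ from an open set of $z$-space onto a neighbourhood of $(x_0,u_0)$ contained in $\Omega$, with $\sum_{i=1}^m n_{z^i}=n_x+n_u$, in whose coordinates the system is represented by equations $\Xi^1_e=0,\dots,\Xi^{n_b}_e=0$ as above (that is, for every $z$ in the domain of $\varphi$, a velocity $\dot z$ satisfies all of them if and only if the $x$-component of $D\varphi(z)\dot z$ equals $f(\varphi(z))$). Suppose that these equations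 are in implicit triangular form at $(z_0,\dot z_0)$, where $z_0=\varphi^{-1}(x_0,u_0)$ and $\dot z_0=D\varphi^{-1}(x_0,u_0)\,(f(x_0,u_0),\dot u_0)$, and that $\sum_{i=1}^{m-1}n_{y^i}=n_u$. Then the system is 1-flat near $\xi_0$. More precisely, $(y^1,\dots,y^{m-1})$, read as a function of $(x,u)$ through $\varphi^{-1}$, is a flat output near $\xi_0$. -/

import Mathlib

open scoped ContDiff

noncomputable section

namespace ControlFlat

/-! ### Control systems and jets of the input -/

/-- The local coordinate space of the pairs `(x, u)`. -/
abbrev StateInput (nx nu : ℕ) : Type := (Fin nx → ℝ) × (Fin nu → ℝ)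

/-- The jet space with coordinates `(x, u, u', u'', …)`; `ξ.2 k` is the `k`-th time derivative
of the input. It carries the product topology, so a neighbourhood of a jet restricts only
finitely many of the derivatives of `u`. -/
abbrev Jet (nx nu : ℕ) : Type := (Fin nx → ℝ) × (ℕ → Fin nu → ℝ)

/-- The point `(x, u)` below a jet `(x, u, u', …)`. -/
def Jet.base {nx nu : ℕ} (ξ : Jet nx nu) : StateInput nx nu := (ξ.1, ξ.2 0)

/-- The velocity `(f(x,u), u', u'', u''', …)` of a jet along the trajectories of `x' = f(x,u)`. -/
def cartanField {nx nu : ℕ} (f : StateInput nx nu → Fin nx → ℝ) (ξ : Jet nx nu) : Jet nx nu :=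
  (f (Jet.base ξ), fun k => ξ.2 (k + 1))

/-- Total time derivative of a function on the jet space along `x' = f(x,u)`: the derivative in
the direction `f(x,u) ∂_x + u' ∂_u + u'' ∂_{u'} + …`. -/
def totalDeriv {nx nu : ℕ} (f : StateInput nx nu → Fin nx → ℝ) (g : Jet nx nu → ℝ) :
    Jet nx nu → ℝ :=
  fun ξ => lineDeriv ℝ g ξ (cartanField f ξ)

/-- The `k`-th time derivative of the component `y^i = h^i(x,u)` along `x' = f(x,u)`, as a
function on the jet space. -/
def outputDeriv {nx nu : ℕ} {ι : Type} (f : StateInput nx nu → Fin nx → ℝ)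
    (h : StateInput nx nu → ι → ℝ) (k : ℕ) (i : ι) : Jet nx nu → ℝ :=
  (totalDeriv f)^[k] (fun ξ => h (Jet.base ξ) i)

/-- The functions `y^i = h^i(x,u)` are differentially independent at the jet `ξ`: the
differentials at `ξ` of all the time derivatives of all the `y^i` are linearly independent. -/
def DifferentiallyIndependentAt {nx nu : ℕ} {ι : Type} (f : StateInput nx nu → Fin nx → ℝ)
    (h : StateInput nx nu → ι → ℝ) (ξ : Jet nx nu) : Prop :=
  LinearIndependent ℝ
    (fun (p : ℕ × ι) (v : Jet nx nu) => lineDeriv ℝ (outputDeriv f h p.1 p.2) ξ v)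

/-- `y = h(x,u)` is a flat output of `x' = f(x,u)` near the jet `ξ₀`: it consists of `n_u` smooth
functions which, on a neighbourhood of `ξ₀` in the jet space, are differentially independent and
parameterize `(x,u)` smoothly through `y` and finitely many of its time derivatives. -/
structure IsFlatOutputAt {nx nu : ℕ} {ι : Type} [Fintype ι] (f : StateInput nx nu → Fin nx → ℝ)
    (h : StateInput nx nu → ι → ℝ) (ξ₀ : Jet nx nu) : Prop where
  card_eq : Fintype.card ι = nu
  smooth : ∃ W : Set (StateInput nx nu), IsOpen W ∧ Jet.base ξ₀ ∈ W ∧ ContDiffOn ℝ ∞ h W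
  flat : ∃ N : Set (Jet nx nu), IsOpen N ∧ ξ₀ ∈ N ∧
    (∀ ξ ∈ N, DifferentiallyIndependentAt f h ξ) ∧
    ∃ (r : ℕ) (V : Set (Fin (r + 1) → ι → ℝ)) (F : (Fin (r + 1) → ι → ℝ) → StateInput nx nu),
      IsOpen V ∧ ContDiffOn ℝ ∞ F V ∧
      ∀ ξ ∈ N, (fun (k : Fin (r + 1)) (i : ι) => outputDeriv f h k i ξ) ∈ V ∧
        F (fun (k : Fin (r + 1)) (i : ι) => outputDeriv f h k i ξ) = Jet.base ξ

/-- `x' = f(x,u)` is 1-flat near the jet `ξ₀`: it has a flat output that is a function of `x`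
and `u` only. -/
def IsOneFlatAt {nx nu : ℕ} (f : StateInput nx nu → Fin nx → ℝ) (ξ₀ : Jet nx nu) : Prop :=
  ∃ h : StateInput nx nu → Fin nu → ℝ, IsFlatOutputAt f h ξ₀

/-! ### The implicit triangular form -/

/-- The partition `z = (z^1, …, z^m)`, `m = n_b + 1`, with `z^i = (y^i, ẑ^i)`, where `z^1 = y^1`
and `z^m = ẑ^m`. Blocks are numbered from `0`: the block `i : Fin (nb + 1)` is `z^{i+1}`, with
`ny i` coordinates `y` and `nh i` coordinates `ẑ`. -/
structure BlockPartition where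
  nb : ℕ
  ny : Fin (nb + 1) → ℕ
  nh : Fin (nb + 1) → ℕ
  nh_first : nh 0 = 0
  ny_last : ny (Fin.last nb) = 0

/-- Dimension of the block `z^{i+1}`. -/
def BlockPartition.nz (B : BlockPartition) (i : Fin (B.nb + 1)) : ℕ := B.ny i + B.nh i

/-- Indices of all the `z`-coordinates: a block, and in it a `y`- or a `ẑ`-coordinate. -/
abbrev BlockPartition.Index (B : BlockPartition) : Type :=
  Σ i : Fin (B.nb + 1), Fin (B.ny i) ⊕ Fin (B.nh i)

/-- Indices of all the `y`-coordinates. -/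
abbrev BlockPartition.YIndex (B : BlockPartition) : Type :=
  Σ i : Fin (B.nb + 1), Fin (B.ny i)

/-- The coordinate space of `z`. -/
abbrev BlockPartition.Coord (B : BlockPartition) : Type := B.Index → ℝ

/-- The `z`-coordinates belonging to `y = (y^1, …, y^{m-1})`. -/
def BlockPartition.yPart (B : BlockPartition) (z : B.Coord) : B.YIndex → ℝ :=
  fun p => z ⟨p.1, Sum.inl p.2⟩

/-- The coordinates on which the coefficients of the `i`-th block of equations may depend: with
one-based numbering of blocks, `z^1, …, z^i` and `ẑ^{i+1}`. -/
def BlockPartition.Allowed (B : BlockPartition) (i : Fin B.nb) : B.Index → Prop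
  | ⟨k, Sum.inl _⟩ => k ≤ i.castSucc
  | ⟨k, Sum.inr _⟩ => k ≤ i.succ

/-- The coefficients, smooth on a set `Z`, of implicit differential equations
`a^i_1 ż^1 + … + a^i_i ż^i - b^i = 0`, `i = 1, …, n_b`, of triangular shape. The block `i` has
as many equations as `ẑ^{i+1}` has coordinates, and its coefficients are functions of
`z^1, …, z^i, ẑ^{i+1}` only. -/
structure TriangularEquations (B : BlockPartition) (Z : Set B.Coord) where
  a : (i : Fin B.nb) → Fin (B.nh i.succ) → B.Index → B.Coord → ℝ
  b : (i : Fin B.nb) → Fin (B.nh i.succ) → B.Coord → ℝ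
  a_smooth : ∀ i j κ, ContDiffOn ℝ ∞ (a i j κ) Z
  b_smooth : ∀ i j, ContDiffOn ℝ ∞ (b i j) Z
  a_dep : ∀ i j κ, ∀ z ∈ Z, ∀ z' ∈ Z, (∀ l, B.Allowed i l → z l = z' l) → a i j κ z = a i j κ z'
  b_dep : ∀ i j, ∀ z ∈ Z, ∀ z' ∈ Z, (∀ l, B.Allowed i l → z l = z' l) → b i j z = b i j z'

/-- The left-hand side `Ξ^{i,j}(z, ż)` of the `j`-th equation of the `i`-th block. Only the
velocities of the blocks `z^1, …, z^i` occur. -/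
def TriangularEquations.lhs {B : BlockPartition} {Z : Set B.Coord} (T : TriangularEquations B Z)
    (i : Fin B.nb) (j : Fin (B.nh i.succ)) (z zdot : B.Coord) : ℝ :=
  (∑ κ : B.Index, if κ.1 ≤ i.castSucc then T.a i j κ z * zdot κ else 0) - T.b i j z

/-- The Jacobian matrix `[∂Ξ^i / ∂ẑ^{i+1}]` at `(z, ż)`, with `ż` held fixed. -/
def TriangularEquations.jacobian {B : BlockPartition} {Z : Set B.Coord}
    (T : TriangularEquations B Z) (i : Fin B.nb) (z zdot : B.Coord) :
    Matrix (Fin (B.nh i.succ)) (Fin (B.nh i.succ)) ℝ :=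
  Matrix.of fun j l =>
    fderiv ℝ (fun w => T.lhs i j w zdot) z (Pi.single ⟨i.succ, Sum.inr l⟩ 1)

/-- The regularity condition of the implicit triangular form at `(z, ż)`. -/
def TriangularEquations.RegularAt {B : BlockPartition} {Z : Set B.Coord}
    (T : TriangularEquations B Z) (z zdot : B.Coord) : Prop :=
  ∀ i : Fin B.nb, (T.jacobian i z zdot).det ≠ 0

/-- In the coordinates `(x,u) = φ(z)` the system `x' = f(x,u)` is represented by the equations
`T`: a velocity `ż` at `z` solves `T` if and only if it is a velocity of the system. -/
def Represents {nx nu : ℕ} {B : BlockPartition} {Z : Set B.Coord} (T : TriangularEquations B Z)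
    (φ : B.Coord → StateInput nx nu) (f : StateInput nx nu → Fin nx → ℝ) : Prop :=
  ∀ z ∈ Z, ∀ zdot : B.Coord,
    (∀ i j, T.lhs i j z zdot = 0) ↔ (fderiv ℝ φ z zdot).1 = f (φ z)

end ControlFlat

end

noncomputable section

namespace ControlFlat

open Filter Topology Set

/-! The triangular equations can be solved block by block for `z` in terms of the sequence `Y = (y,
y', y'', …)`. The block `z^1 = y^1` is known. Once `z^1, …, z^i` are functions of `Y`, so are their
velocities, by differentiation along the shift of sequences; the regular Jacobian then lets the
implicit function theorem extract `ẑ^{i+1}` from `Ξ^i = 0`, while `y^{i+1}` is read off `Y`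
(`IsPartialParam.exists_succ`).

The resulting function `g` has two properties. At the output jet of any jet near `ξ₀` it returns the
true `z`, so `φ ∘ g` is the parameterization `F` of `(x,u)`. It also solves the equations for every
sequence `Y` near the output jet of `ξ₀`. Since the equations are equivalent to the dynamics,
`jetOfOutput` therefore carries the shift to the Cartan field (`jetOfOutputDeriv_seqShift`), and the
`k`-th derivative of the output at `jetOfOutput φ g Y` is `Y k` (`outputDeriv_jetOfOutput`). The
differentials of these derivatives thus pull back to coordinate functionals, which are independent.
Every jet near `ξ₀` is recovered from its output jet by `jetOfOutput`, so independence holds on a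
neighbourhood.

Jets and sequences form spaces that are not normed. Calculus on them uses functions that factor
locally through a continuous linear map to a normed space (`CylSmoothAt`). Their chain rule needs
only the velocity of a curve at one point, so straight lines replace integral curves throughout. -/

/-! ### Functions of finitely many coordinates on a topological vector space -/

section CylSmooth

variable {J : Type} [AddCommGroup J] [Module ℝ J] [TopologicalSpace J]

/-- Near `p`, the function `g` is a smooth function of a continuous linear image of its argument
in a normed space. On a product this means: a smooth function of finitely many coordinates. -/
def CylSmoothAt {F : Type} [NormedAddCommGroup F] [NormedSpace ℝ F] (g : J → F) (p : J) : Prop :=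
  ∃ (E : Type) (_ : NormedAddCommGroup E) (_ : NormedSpace ℝ E) (L : J →L[ℝ] E) (G : E → F)
    (O : Set E), IsOpen O ∧ L p ∈ O ∧ ContDiffOn ℝ ∞ G O ∧ ∀ q, L q ∈ O → g q = G (L q)

/-- The curve `c` has velocity `v` at time `0`. -/
def HasVelocity (c : ℝ → J) (v : J) : Prop :=
  Tendsto (fun t : ℝ => t⁻¹ • (c t - c 0)) (𝓝[≠] 0) (𝓝 v)

variable {F F' : Type} [NormedAddCommGroup F] [NormedSpace ℝ F]
  [NormedAddCommGroup F'] [NormedSpace ℝ F']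

theorem hasVelocity_iff_hasDerivAt {c : ℝ → F} {v : F} : HasVelocity c v ↔ HasDerivAt c v 0 := by
  rw [hasDerivAt_iff_tendsto_slope_zero, HasVelocity]
  simp

theorem HasVelocity.clm {c : ℝ → J} {v : J} (hc : HasVelocity c v) (L : J →L[ℝ] F) :
    HasDerivAt (fun t => L (c t)) (L v) 0 := by
  rw [← hasVelocity_iff_hasDerivAt, HasVelocity]
  have := (L.continuous.tendsto v).comp hc
  refine this.congr fun t => ?_
  simp

theorem hasVelocity_line [ContinuousSMul ℝ J] (p v : J) :
    HasVelocity (fun t : ℝ => p + t • v) v := by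
  refine tendsto_const_nhds.congr' ?_
  filter_upwards [self_mem_nhdsWithin] with t ht
  have ht : t ≠ 0 := ht
  simp [smul_smul, ht]

theorem tendsto_line [ContinuousSMul ℝ J] [ContinuousAdd J] (p v : J) :
    Tendsto (fun t : ℝ => p + t • v) (𝓝 0) (𝓝 p) := by
  have : Continuous fun t : ℝ => p + t • v := by fun_prop
  simpa using this.tendsto 0

theorem hasVelocity_pi {ι : Type} {c : ℝ → ι → F} {v : ι → F} :
    HasVelocity c v ↔ ∀ i, HasDerivAt (fun t => c t i) (v i) 0 := by
  simp only [← hasVelocity_iff_hasDerivAt, HasVelocity, tendsto_pi_nhds]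
  rfl

theorem HasVelocity.prodMk {J' : Type} [AddCommGroup J'] [Module ℝ J'] [TopologicalSpace J']
    {c : ℝ → J} {v : J} {c' : ℝ → J'} {v' : J'} (h : HasVelocity c v) (h' : HasVelocity c' v') :
    HasVelocity (fun t => (c t, c' t)) (v, v') :=
  Tendsto.prodMk_nhds h h'

/-- The derivative of `g` along the vector field `X`. -/
def derivAlong (X : J → J) (g : J → F) (p : J) : F := lineDeriv ℝ g p (X p)

namespace CylSmoothAt

theorem eventually {g : J → F} {p : J} (h : CylSmoothAt g p) : ∀ᶠ q in 𝓝 p, CylSmoothAt g q := by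
  obtain ⟨E, _, _, L, G, O, hO, hp, hG, hg⟩ := h
  filter_upwards [(hO.preimage L.continuous).mem_nhds hp] with q hq
  exact ⟨E, _, _, L, G, O, hO, hq, hG, hg⟩

theorem clm (L : J →L[ℝ] F) (p : J) : CylSmoothAt (fun q => L q) p :=
  ⟨F, _, _, L, id, univ, isOpen_univ, mem_univ _, contDiffOn_id, fun _ _ => rfl⟩

theorem const (c : F) (p : J) : CylSmoothAt (fun _ => c) p :=
  ⟨F, _, _, 0, fun _ => c, univ, isOpen_univ, mem_univ _, contDiffOn_const, fun _ _ => rfl⟩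

theorem continuousAt {g : J → F} {p : J} (h : CylSmoothAt g p) : ContinuousAt g p := by
  obtain ⟨E, _, _, L, G, O, hO, hp, hG, hg⟩ := h
  have h1 : ContinuousAt (fun q => G (L q)) p :=
    (hG.continuousOn.continuousAt (hO.mem_nhds hp)).comp L.continuous.continuousAt
  refine h1.congr ?_
  filter_upwards [(hO.preimage L.continuous).mem_nhds hp] with q hq
  exact (hg q hq).symm

theorem comp {g : J → F} {p : J} (h : CylSmoothAt g p) {H : F → F'} {U : Set F} (hU : IsOpen U)
    (hH : ContDiffOn ℝ ∞ H U) (hp : g p ∈ U) : CylSmoothAt (fun q => H (g q)) p := by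
  obtain ⟨E, _, _, L, G, O, hO, hpO, hG, hg⟩ := h
  refine ⟨E, _, _, L, fun e => H (G e), O ∩ G ⁻¹' U, hG.continuousOn.isOpen_inter_preimage hO hU,
    ⟨hpO, ?_⟩, hH.comp (hG.mono inter_subset_left) fun e he => he.2, fun q hq => ?_⟩
  · rwa [mem_preimage, ← hg p hpO]
  · exact congrArg H (hg q hq.1)

theorem comp_contDiff {g : J → F} {p : J} (h : CylSmoothAt g p) {H : F → F'}
    (hH : ContDiff ℝ ∞ H) : CylSmoothAt (fun q => H (g q)) p :=
  h.comp isOpen_univ hH.contDiffOn (mem_univ _)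

theorem prodMk {g : J → F} {g' : J → F'} {p : J} (h : CylSmoothAt g p) (h' : CylSmoothAt g' p) :
    CylSmoothAt (fun q => (g q, g' q)) p := by
  obtain ⟨E, _, _, L, G, O, hO, hpO, hG, hg⟩ := h
  obtain ⟨E', _, _, L', G', O', hO', hpO', hG', hg'⟩ := h'
  refine ⟨E × E', _, _, L.prod L', fun e => (G e.1, G' e.2), O ×ˢ O', hO.prod hO', ⟨hpO, hpO'⟩,
    ?_, fun q hq => ?_⟩
  · exact (hG.comp contDiffOn_fst fun e he => he.1).prodMk
      (hG'.comp contDiffOn_snd fun e he => he.2)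
  · exact Prod.ext (hg q hq.1) (hg' q hq.2)

theorem pi {ι : Type} [Fintype ι] {g : J → ι → F} {p : J}
    (h : ∀ i, CylSmoothAt (fun q => g q i) p) : CylSmoothAt g p := by
  choose E n1 n2 L G O hO hpO hG hg using h
  refine ⟨∀ i, E i, inferInstance, inferInstance, ContinuousLinearMap.pi L, fun e i => G i (e i),
    univ.pi O, isOpen_set_pi finite_univ fun i _ => hO i, fun i _ => hpO i, ?_, fun q hq => ?_⟩
  · exact contDiffOn_pi.2 fun i => (hG i).comp (ContinuousLinearMap.proj (R := ℝ) (φ := E) i).contDiff.contDiffOn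
      fun e he => he i (mem_univ i)
  · funext i
    exact hg i q (hq i (mem_univ i))

theorem apply {ι : Type} [Fintype ι] {g : J → ι → F} {p : J} (h : CylSmoothAt g p) (i : ι) :
    CylSmoothAt (fun q => g q i) p :=
  h.comp_contDiff (contDiff_apply ℝ F i)

theorem hasDerivAt_comp [ContinuousSMul ℝ J] {g : J → F} {c : ℝ → J} {v : J}
    (h : CylSmoothAt g (c 0)) (hc : HasVelocity c v) :
    HasDerivAt (fun t => g (c t)) (lineDeriv ℝ g (c 0) v) 0 := by
  obtain ⟨E, _, _, L, G, O, hO, hp, hG, hg⟩ := h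
  -- The derivative depends on the curve only through its starting point and velocity; `key` is used
  -- for the straight line, which identifies the line derivative, and then for `c`.
  have key : ∀ {d : ℝ → J}, d 0 = c 0 → HasVelocity d v →
      HasDerivAt (fun t => g (d t)) (fderiv ℝ G (L (c 0)) (L v)) 0 := by
    intro d hd hv
    have h1 := hv.clm L
    have h2 : HasFDerivAt G (fderiv ℝ G (L (c 0))) (L (d 0)) := by
      rw [hd]
      exact ((hG.contDiffAt (hO.mem_nhds hp)).differentiableAt (by simp)).hasFDerivAt
    refine (h2.comp_hasDerivAt (0 : ℝ) h1).congr_of_eventuallyEq ?_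
    have h3 : ∀ᶠ t in 𝓝 (0 : ℝ), L (d t) ∈ O :=
      h1.continuousAt.eventually (hO.mem_nhds (by simpa [hd] using hp))
    filter_upwards [h3] with t ht
    exact hg _ ht
  have h4 := key (d := fun t => c 0 + t • v) (by simp) (hasVelocity_line _ _)
  have h5 : lineDeriv ℝ g (c 0) v = fderiv ℝ G (L (c 0)) (L v) := h4.deriv
  rw [h5]
  exact key rfl hc

theorem hasLineDerivAt [ContinuousSMul ℝ J] {g : J → F} {p : J} (h : CylSmoothAt g p) (v : J) :
    HasLineDerivAt ℝ g (lineDeriv ℝ g p v) p v := by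
  have := hasDerivAt_comp (c := fun t : ℝ => p + t • v) (by simpa using h) (hasVelocity_line p v)
  simpa [HasLineDerivAt] using this

/-- If `g = G ∘ L` locally, the derivative along `X` is `fderiv ℝ G (L q) (L (X q))`, so only the
images of `X` under continuous linear maps to normed spaces need be smooth. This is what allows
differentiation to be iterated. -/
theorem derivAlong [ContinuousSMul ℝ J] {X : J → J} {g : J → F} {p : J} (h : CylSmoothAt g p)
    (hX : ∀ (E : Type) [NormedAddCommGroup E] [NormedSpace ℝ E] (L : J →L[ℝ] E),
      CylSmoothAt (fun q => L (X q)) p) :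
    CylSmoothAt (derivAlong X g) p := by
  obtain ⟨E, _, _, L, G, O, hO, hp, hG, hg⟩ := h
  have hd : ContDiffOn ℝ ∞ (fun e : E × E => fderiv ℝ G e.1 e.2) (O ×ˢ univ) :=
    ((hG.fderiv_of_isOpen hO (by simp)).comp contDiffOn_fst fun e he => he.1).clm_apply
      contDiffOn_snd
  have h1 := ((clm L p).prodMk (hX E L)).comp (hO.prod isOpen_univ) hd ⟨hp, mem_univ _⟩
  obtain ⟨E', _, _, L', G', O', hO', hp', hG', hg'⟩ := h1
  refine ⟨E × E', _, _, L.prod L', fun e => G' e.2, O ×ˢ O', hO.prod hO', ⟨hp, hp'⟩,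
    hG'.comp contDiffOn_snd fun e he => he.2, fun q hq => ?_⟩
  refine Eq.trans ?_ (hg' q hq.2)
  have h2 : HasFDerivAt G (fderiv ℝ G (L q)) (L (q + (0 : ℝ) • X q)) := by
    simpa using
      ((hG.contDiffAt (hO.mem_nhds hq.1)).differentiableAt (by simp)).hasFDerivAt
  have h3 := (hasVelocity_line q (X q)).clm L
  have h4 : HasDerivAt (fun t : ℝ => g (q + t • X q)) (fderiv ℝ G (L q) (L (X q))) 0 := by
    refine (h2.comp_hasDerivAt (0 : ℝ) h3).congr_of_eventuallyEq ?_
    have h3 : ∀ᶠ t in 𝓝 (0 : ℝ), L (q + t • X q) ∈ O :=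
      h3.continuousAt.eventually (hO.mem_nhds (by simpa using hq.1))
    filter_upwards [h3] with t ht
    exact hg _ ht
  exact h4.deriv

end CylSmoothAt

end CylSmooth

/-! ### Sequences of vectors -/

section Seq

variable {X : Type} [NormedAddCommGroup X] [NormedSpace ℝ X]

/-- Extension of a finite sequence by zero. -/
def extendByZero (r : ℕ) : (Fin (r + 1) → X) →L[ℝ] (ℕ → X) :=
  ContinuousLinearMap.pi fun k =>
    if hk : k < r + 1 then ContinuousLinearMap.proj ⟨k, hk⟩ else 0

theorem extendByZero_apply_of_le {r k : ℕ} (hk : k ≤ r) (y : Fin (r + 1) → X) :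
    extendByZero r y k = y ⟨k, Nat.lt_succ_of_le hk⟩ := by
  simp [extendByZero, hk]

/-- A continuous linear map from the space of sequences to a normed space depends on finitely many
terms only. -/
theorem exists_clm_apply_eq_extendByZero {E : Type} [NormedAddCommGroup E] [NormedSpace ℝ E]
    (L : (ℕ → X) →L[ℝ] E) :
    ∃ r, ∀ y, L y = L (extendByZero r fun k => y k) := by
  have h0 : L ⁻¹' Metric.ball 0 1 ∈ 𝓝 (0 : ℕ → X) :=
    L.continuous.continuousAt.preimage_mem_nhds (by simpa using Metric.ball_mem_nhds _ one_pos)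
  rw [nhds_pi, Filter.mem_pi] at h0
  obtain ⟨I, hI, t, ht, hsub⟩ := h0
  obtain ⟨r, hr⟩ := hI.bddAbove
  have hz : ∀ y : ℕ → X, (∀ k ≤ r, y k = 0) → L y = 0 := by
    intro y hy
    by_contra hne
    have hn : 0 < ‖L y‖ := norm_pos_iff.2 hne
    -- The neighbourhood constrains only terms up to `r`, where `y` vanishes, so it contains all
    -- multiples of `y`; this one has an image of norm exactly 1.
    have hmem : (‖L y‖⁻¹ • y) ∈ I.pi t := fun k hk => by
      simpa [hy k (hr hk)] using mem_of_mem_nhds (ht k)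
    have h2 := hsub hmem
    simp [norm_smul, hn.ne'] at h2
  refine ⟨r, fun y => sub_eq_zero.1 ?_⟩
  rw [← map_sub]
  refine hz _ fun k hk => ?_
  simp [extendByZero_apply_of_le hk]

/-- The shift of sequences. -/
def seqShift : (ℕ → X) →L[ℝ] (ℕ → X) :=
  ContinuousLinearMap.pi fun k => ContinuousLinearMap.proj (k + 1)

@[simp] theorem seqShift_apply (y : ℕ → X) (k : ℕ) : seqShift y k = y (k + 1) := rfl

end Seq

/-! ### An implicit function theorem -/

/-- Being `C^∞` at a point yields, for each finite order, a neighbourhood that may shrink with the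
order. To be smooth on one open set, the implicit function is compared with the implicit functions
based at the nearby points of its graph: local uniqueness makes them coincide. -/
theorem exists_contDiffOn_implicit {P W V : Type}
    [NormedAddCommGroup P] [NormedSpace ℝ P] [CompleteSpace P]
    [NormedAddCommGroup W] [NormedSpace ℝ W] [CompleteSpace W]
    [NormedAddCommGroup V] [NormedSpace ℝ V] [CompleteSpace V]
    {Ψ : P × W → V} {O : Set (P × W)} (hO : IsOpen O) (hΨ : ContDiffOn ℝ ∞ Ψ O)
    {p₀ : P} {w₀ : W} (h₀ : (p₀, w₀) ∈ O) (hz : Ψ (p₀, w₀) = 0)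
    (hinv : (fderiv ℝ Ψ (p₀, w₀) ∘L .inr ℝ P W).IsInvertible) :
    ∃ (A : Set P) (ψ : P → W), IsOpen A ∧ p₀ ∈ A ∧ ContDiffOn ℝ ∞ ψ A ∧ ψ p₀ = w₀ ∧
      (∀ p ∈ A, Ψ (p, ψ p) = 0) ∧ ∀ᶠ q in 𝓝 (p₀, w₀), Ψ q = 0 → q.2 = ψ q.1 := by
  have hat : ∀ q ∈ O, ContDiffAt ℝ ∞ Ψ q := fun q hq => hΨ.contDiffAt (hO.mem_nhds hq)
  have hn : (∞ : WithTop ℕ∞) ≠ 0 := by simp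
  have c₀ := hat _ h₀
  set ψ := c₀.implicitFunction hn hinv with hψdef
  have hψ₀ : ψ p₀ = w₀ := c₀.implicitFunction_apply_self hn hinv
  have hψc : ContDiffAt ℝ ∞ ψ p₀ := c₀.contDiffAt_implicitFunction hn hinv
  have hψz : ∀ᶠ p in 𝓝 p₀, Ψ (p, ψ p) = 0 := by
    filter_upwards [c₀.eventually_apply_implicitFunction hn hinv] with p hp
    rw [← hz, ← hp]
  have hiff : ∀ᶠ q in 𝓝 (p₀, w₀), Ψ q = 0 ↔ ψ q.1 = q.2 := by
    filter_upwards [c₀.eventually_apply_eq_iff_implicitFunction hn hinv] with q hq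
    rw [← hq, hz]
  have hinv' : ∀ᶠ q in 𝓝 (p₀, w₀), (fderiv ℝ Ψ q ∘L .inr ℝ P W).IsInvertible := by
    have hc : ContinuousAt (fun q => fderiv ℝ Ψ q ∘L .inr ℝ P W) (p₀, w₀) := by
      have := (c₀.fderiv_right (m := ∞) (by simp)).continuousAt
      exact this.clm_comp continuousAt_const
    -- Invertible operators form an open set, so the theorem applies again at nearby points.
    obtain ⟨e, he⟩ := hinv
    have := hc.eventually (he ▸ ContinuousLinearEquiv.nhds e)
    filter_upwards [this] with q hq
    obtain ⟨e', he'⟩ := hq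
    exact ⟨e', he'⟩
  have hgood : ∀ᶠ q in 𝓝 (p₀, w₀), (Ψ q = 0 ↔ ψ q.1 = q.2) ∧
      (fderiv ℝ Ψ q ∘L .inr ℝ P W).IsInvertible ∧ q ∈ O :=
    hiff.and (hinv'.and (hO.mem_nhds h₀))
  have hgraph : Tendsto (fun p => (p, ψ p)) (𝓝 p₀) (𝓝 (p₀, w₀)) := by
    have := (continuousAt_id.prodMk hψc.continuousAt).tendsto
    simpa [hψ₀] using this
  have hA := (hψz.and (hgraph.eventually hgood.eventually_nhds))
  obtain ⟨A, hAsub, hAo, hpA⟩ := eventually_nhds_iff.1 hA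
  refine ⟨A, ψ, hAo, hpA, fun p hp => ?_, hψ₀, fun p hp => (hAsub p hp).1, ?_⟩
  · obtain ⟨hzp, hg⟩ := hAsub p hp
    obtain ⟨-, hi, hOp⟩ := hg.self_of_nhds
    have c₁ := hat _ hOp
    have h2 := c₁.contDiffAt_implicitFunction hn hi
    refine (h2.congr_of_eventuallyEq ?_).contDiffWithinAt
    have h3 : Tendsto (fun p' => (p', c₁.implicitFunction hn hi p')) (𝓝 p) (𝓝 (p, ψ p)) := by
      have h4 := (continuousAt_id.prodMk h2.continuousAt).tendsto
      have h5 : c₁.implicitFunction hn hi p = ψ p := c₁.implicitFunction_apply_self hn hi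
      simp only [id, h5] at h4
      exact h4
    filter_upwards [h3.eventually hg, c₁.eventually_apply_implicitFunction hn hi] with p' h6 h7
    exact h6.1.1 (h7.trans hzp)
  · filter_upwards [hiff] with q hq h
    exact (hq.1 h).symm

theorem CylSmoothAt.hasDerivAt_comp_of_eq {J F : Type} [AddCommGroup J] [Module ℝ J]
    [TopologicalSpace J] [ContinuousSMul ℝ J] [NormedAddCommGroup F] [NormedSpace ℝ F]
    {g : J → F} {p : J} {c : ℝ → J} {v : J} (h : CylSmoothAt g p) (hc : HasVelocity c v)
    (h0 : c 0 = p) : HasDerivAt (fun t => g (c t)) (lineDeriv ℝ g p v) 0 := by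
  subst h0
  exact h.hasDerivAt_comp hc

/-! ### Output jets -/

section Output

variable {nx nu : ℕ} {ι : Type}

/-- The projection of jets to `(x, u)`, as a continuous linear map. -/
def baseCLM (nx nu : ℕ) : Jet nx nu →L[ℝ] StateInput nx nu :=
  (ContinuousLinearMap.fst ℝ (Fin nx → ℝ) (ℕ → Fin nu → ℝ)).prod
    ((ContinuousLinearMap.proj 0).comp
      (ContinuousLinearMap.snd ℝ (Fin nx → ℝ) (ℕ → Fin nu → ℝ)))

theorem continuous_base : Continuous (Jet.base : Jet nx nu → StateInput nx nu) :=
  (baseCLM nx nu).continuous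

theorem cylSmoothAt_base (ξ : Jet nx nu) : CylSmoothAt (Jet.base : Jet nx nu → _) ξ :=
  CylSmoothAt.clm (baseCLM nx nu) ξ

/-- The sequence of the time derivatives of the output. -/
def outputJet (f : StateInput nx nu → Fin nx → ℝ) (h : StateInput nx nu → ι → ℝ)
    (ξ : Jet nx nu) : ℕ → ι → ℝ := fun k i => outputDeriv f h k i ξ

theorem outputDeriv_zero (f : StateInput nx nu → Fin nx → ℝ) (h : StateInput nx nu → ι → ℝ)
    (i : ι) (ξ : Jet nx nu) : outputDeriv f h 0 i ξ = h (Jet.base ξ) i := rfl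

theorem outputDeriv_succ (f : StateInput nx nu → Fin nx → ℝ) (h : StateInput nx nu → ι → ℝ)
    (k : ℕ) (i : ι) :
    outputDeriv f h (k + 1) i = derivAlong (cartanField f) (outputDeriv f h k i) := by
  unfold outputDeriv
  rw [Function.iterate_succ_apply']
  rfl

variable {f : StateInput nx nu → Fin nx → ℝ} {h : StateInput nx nu → ι → ℝ}
  {U : Set (StateInput nx nu)}

theorem cylSmoothAt_clm_cartanField (hU : IsOpen U) (hf : ContDiffOn ℝ ∞ f U) {ξ : Jet nx nu}
    (hξ : Jet.base ξ ∈ U) (E : Type) [NormedAddCommGroup E] [NormedSpace ℝ E]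
    (L : Jet nx nu →L[ℝ] E) : CylSmoothAt (fun q => L (cartanField f q)) ξ := by
  have h1 : CylSmoothAt (fun q => (f (Jet.base q),
      L.comp ((ContinuousLinearMap.inr ℝ (Fin nx → ℝ) (ℕ → Fin nu → ℝ)).comp
        (seqShift.comp (ContinuousLinearMap.snd ℝ (Fin nx → ℝ) (ℕ → Fin nu → ℝ)))) q)) ξ :=
    ((cylSmoothAt_base ξ).comp hU hf hξ).prodMk (CylSmoothAt.clm _ ξ)
  have h2 := h1.comp_contDiff (H := fun e =>
    L.comp (ContinuousLinearMap.inl ℝ (Fin nx → ℝ) (ℕ → Fin nu → ℝ)) e.1 + e.2)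
    (((ContinuousLinearMap.contDiff _).comp contDiff_fst).add contDiff_snd)
  -- The Cartan field splits as `f(x,u)` in the state component plus the shift in the input
  -- component; the first is smooth, the second linear.
  convert h2 using 2 with q
  simp only [ContinuousLinearMap.comp_apply]
  rw [← map_add]
  congr 1
  refine Prod.ext ?_ ?_
  · simp [cartanField]
  · simp [cartanField]
    rfl

theorem cylSmoothAt_outputDeriv [Fintype ι] (hU : IsOpen U) (hf : ContDiffOn ℝ ∞ f U)
    (hh : ContDiffOn ℝ ∞ h U) (k : ℕ) (i : ι) {ξ : Jet nx nu} (hξ : Jet.base ξ ∈ U) :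
    CylSmoothAt (outputDeriv f h k i) ξ := by
  induction k generalizing ξ with
  | zero => exact ((cylSmoothAt_base ξ).comp hU hh hξ).apply i
  | succ k ih =>
    rw [outputDeriv_succ]
    exact (ih hξ).derivAlong (cylSmoothAt_clm_cartanField hU hf hξ)

theorem continuousAt_outputJet [Fintype ι] (hU : IsOpen U) (hf : ContDiffOn ℝ ∞ f U)
    (hh : ContDiffOn ℝ ∞ h U) {ξ : Jet nx nu} (hξ : Jet.base ξ ∈ U) :
    ContinuousAt (outputJet f h) ξ :=
  continuousAt_pi.2 fun k => continuousAt_pi.2 fun i =>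
    (cylSmoothAt_outputDeriv hU hf hh k i hξ).continuousAt

/-- Taking output jets relates the Cartan field to the shift; total derivatives of functions of the
output jet thus become derivatives along the shift. -/
theorem hasVelocity_outputJet [Fintype ι] (hU : IsOpen U) (hf : ContDiffOn ℝ ∞ f U)
    (hh : ContDiffOn ℝ ∞ h U) {ξ : Jet nx nu} (hξ : Jet.base ξ ∈ U) :
    HasVelocity (fun t : ℝ => outputJet f h (ξ + t • cartanField f ξ))
      (seqShift (outputJet f h ξ)) := by
  refine hasVelocity_pi.2 fun k => hasDerivAt_pi.2 fun i => ?_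
  have := (cylSmoothAt_outputDeriv hU hf hh k i hξ).hasLineDerivAt (cartanField f ξ)
  simp only [seqShift_apply, outputJet, outputDeriv_succ]
  exact this

theorem hasDerivAt_comp_outputJet [Fintype ι] {F : Type} [NormedAddCommGroup F] [NormedSpace ℝ F]
    (hU : IsOpen U) (hf : ContDiffOn ℝ ∞ f U)
    (hh : ContDiffOn ℝ ∞ h U) {ξ : Jet nx nu} (hξ : Jet.base ξ ∈ U) {g : (ℕ → ι → ℝ) → F}
    (hg : CylSmoothAt g (outputJet f h ξ)) :
    HasDerivAt (fun t : ℝ => g (outputJet f h (ξ + t • cartanField f ξ)))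
      (derivAlong seqShift g (outputJet f h ξ)) 0 :=
  hg.hasDerivAt_comp_of_eq (hasVelocity_outputJet hU hf hh hξ) (by simp)

end Output

/-! ### Triangular equations -/

section Triangular

variable {B : BlockPartition} {Z : Set B.Coord} (T : TriangularEquations B Z)

theorem TriangularEquations.lhs_congr_velocity {i : Fin B.nb} (j : Fin (B.nh i.succ))
    (z : B.Coord) {v v' : B.Coord} (hv : ∀ κ : B.Index, κ.1 ≤ i.castSucc → v κ = v' κ) :
    T.lhs i j z v = T.lhs i j z v' := by
  unfold TriangularEquations.lhs
  congr 1
  refine Finset.sum_congr rfl fun κ _ => ?_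
  split_ifs with hκ
  · rw [hv κ hκ]
  · rfl

theorem TriangularEquations.lhs_congr {i : Fin B.nb} (j : Fin (B.nh i.succ))
    {z z' v v' : B.Coord} (hz : z ∈ Z) (hz' : z' ∈ Z) (h : ∀ l, B.Allowed i l → z l = z' l)
    (hv : ∀ κ : B.Index, κ.1 ≤ i.castSucc → v κ = v' κ) :
    T.lhs i j z v = T.lhs i j z' v' := by
  rw [T.lhs_congr_velocity j z hv]
  unfold TriangularEquations.lhs
  simp only [T.a_dep i j _ z hz z' hz' h, T.b_dep i j z hz z' hz' h]

theorem TriangularEquations.contDiffOn_lhs (i : Fin B.nb) (j : Fin (B.nh i.succ)) :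
    ContDiffOn ℝ ∞ (fun q : B.Coord × B.Coord => T.lhs i j q.1 q.2) (Z ×ˢ univ) := by
  unfold TriangularEquations.lhs
  refine ContDiffOn.sub (ContDiffOn.sum fun κ _ => ?_) ?_
  · split_ifs
    · refine ContDiffOn.mul ((T.a_smooth i j κ).comp contDiffOn_fst fun q hq => hq.1) ?_
      exact ((contDiff_apply ℝ ℝ κ).comp contDiff_snd).contDiffOn
    · exact contDiffOn_const
  · exact (T.b_smooth i j).comp contDiffOn_fst fun q hq => hq.1

open Classical in
/-- Replace the coordinates `ẑ` of the block `i + 1` by `w`. -/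
def setHat (i : Fin B.nb) (z : B.Coord) (w : Fin (B.nh i.succ) → ℝ) : B.Coord :=
  fun κ => if h : ∃ l, κ = ⟨i.succ, Sum.inr l⟩ then w h.choose else z κ

/-- The coordinates `ẑ` of the block `i + 1`. -/
def hat (i : Fin B.nb) (z : B.Coord) : Fin (B.nh i.succ) → ℝ := fun l => z ⟨i.succ, Sum.inr l⟩

theorem setHat_apply (i : Fin B.nb) (z : B.Coord) (w : Fin (B.nh i.succ) → ℝ)
    (l : Fin (B.nh i.succ)) : setHat i z w ⟨i.succ, Sum.inr l⟩ = w l := by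
  have h : ∃ l', (⟨i.succ, Sum.inr l⟩ : B.Index) = ⟨i.succ, Sum.inr l'⟩ := ⟨l, rfl⟩
  rw [setHat, dif_pos h]
  exact congrArg w (Sum.inr.inj (eq_of_heq (Sigma.mk.inj h.choose_spec).2)).symm

theorem setHat_of_ne {i : Fin B.nb} (z : B.Coord) (w : Fin (B.nh i.succ) → ℝ) {κ : B.Index}
    (h : ∀ l, κ ≠ ⟨i.succ, Sum.inr l⟩) : setHat i z w κ = z κ :=
  dif_neg fun ⟨l, hl⟩ => h l hl

theorem setHat_of_le {i : Fin B.nb} (z : B.Coord) (w : Fin (B.nh i.succ) → ℝ) {κ : B.Index}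
    (h : κ.1 ≤ i.castSucc) : setHat i z w κ = z κ :=
  setHat_of_ne z w fun l hl => by
    subst hl
    exact absurd (i.castSucc_lt_succ) (not_lt.2 h)

@[simp] theorem setHat_hat (i : Fin B.nb) (z : B.Coord) : setHat i z (hat i z) = z := by
  funext κ
  by_cases h : ∃ l, κ = ⟨i.succ, Sum.inr l⟩
  · obtain ⟨l, rfl⟩ := h
    rw [setHat_apply]; rfl
  · push Not at h
    exact setHat_of_ne _ _ h

theorem setHat_hat_add_smul_single (i : Fin B.nb) (z : B.Coord) (l : Fin (B.nh i.succ)) (t : ℝ) :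
    setHat i z (hat i z + t • Pi.single l 1) =
      z + t • Pi.single (⟨i.succ, Sum.inr l⟩ : B.Index) 1 := by
  funext κ
  by_cases h : ∃ l, κ = ⟨i.succ, Sum.inr l⟩
  · obtain ⟨l', rfl⟩ := h
    rw [setHat_apply]
    by_cases hl : l' = l
    · subst hl; simp [hat]
    · have : (⟨i.succ, Sum.inr l'⟩ : B.Index) ≠ ⟨i.succ, Sum.inr l⟩ := by simpa using hl
      simp [hat, hl, this]
  · push Not at h
    rw [setHat_of_ne _ _ h]
    simp [h l]

theorem contDiff_setHat (i : Fin B.nb) :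
    ContDiff ℝ ∞ fun q : B.Coord × (Fin (B.nh i.succ) → ℝ) => setHat i q.1 q.2 := by
  refine contDiff_pi.2 fun κ => ?_
  by_cases h : ∃ l, κ = ⟨i.succ, Sum.inr l⟩
  · obtain ⟨l, rfl⟩ := h
    simp only [setHat_apply]
    exact (contDiff_apply ℝ ℝ l).comp contDiff_snd
  · push Not at h
    simp only [setHat_of_ne _ _ h]
    exact (contDiff_apply ℝ ℝ κ).comp contDiff_fst

/-- The `i`-th block of equations as a function of `((z, ż), w)`, where `w` replaces the
coordinates `ẑ` of the block `i + 1`. -/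
def TriangularEquations.blockMap (i : Fin B.nb)
    (q : (B.Coord × B.Coord) × (Fin (B.nh i.succ) → ℝ)) : Fin (B.nh i.succ) → ℝ :=
  fun j => T.lhs i j (setHat i q.1.1 q.2) q.1.2

/-- The set on which `blockMap` is smooth. -/
def blockDomain (Z : Set B.Coord) (i : Fin B.nb) :
    Set ((B.Coord × B.Coord) × (Fin (B.nh i.succ) → ℝ)) :=
  {q | setHat i q.1.1 q.2 ∈ Z}

theorem isOpen_blockDomain (hZ : IsOpen Z) (i : Fin B.nb) : IsOpen (blockDomain Z i) := by
  have : Continuous fun q : (B.Coord × B.Coord) × (Fin (B.nh i.succ) → ℝ) =>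
      setHat i q.1.1 q.2 :=
    (contDiff_setHat i).continuous.comp (by fun_prop : Continuous fun
      q : (B.Coord × B.Coord) × (Fin (B.nh i.succ) → ℝ) => (q.1.1, q.2))
  exact hZ.preimage this

theorem TriangularEquations.contDiffOn_blockMap (i : Fin B.nb) :
    ContDiffOn ℝ ∞ (T.blockMap i) (blockDomain Z i) := by
  refine contDiffOn_pi.2 fun j => ?_
  have h1 : ContDiff ℝ ∞ fun q : (B.Coord × B.Coord) × (Fin (B.nh i.succ) → ℝ) =>
      (setHat i q.1.1 q.2, q.1.2) :=
    ((contDiff_setHat i).comp ((contDiff_fst.comp contDiff_fst).prodMk contDiff_snd)).prodMk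
      (contDiff_snd.comp contDiff_fst)
  exact (T.contDiffOn_lhs i j).comp h1.contDiffOn fun q hq => ⟨hq, mem_univ _⟩

theorem TriangularEquations.isInvertible_fderiv_blockMap (hZ : IsOpen Z) (i : Fin B.nb)
    {z v : B.Coord} (hz : z ∈ Z) (hdet : (T.jacobian i z v).det ≠ 0) :
    (fderiv ℝ (T.blockMap i) ((z, v), hat i z) ∘L
      .inr ℝ (B.Coord × B.Coord) (Fin (B.nh i.succ) → ℝ)).IsInvertible := by
  set A := fderiv ℝ (T.blockMap i) ((z, v), hat i z) ∘L
      .inr ℝ (B.Coord × B.Coord) (Fin (B.nh i.succ) → ℝ) with hA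
  have hmem : ((z, v), hat i z) ∈ blockDomain Z i := by simpa [blockDomain] using hz
  have hd : HasFDerivAt (T.blockMap i) (fderiv ℝ (T.blockMap i) ((z, v), hat i z))
      ((z, v), hat i z) :=
    (((T.contDiffOn_blockMap i).contDiffAt ((isOpen_blockDomain hZ i).mem_nhds
      hmem)).differentiableAt (by simp)).hasFDerivAt
  -- Moving `w` along the `l`-th axis moves `z` along the coordinate `ẑ^{i+1,l}`, so both matrices
  -- have the same entries.
  have hmat : LinearMap.toMatrix' (A : (Fin (B.nh i.succ) → ℝ) →ₗ[ℝ] _) = T.jacobian i z v := by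
    ext j l
    rw [LinearMap.toMatrix'_apply]
    have h1 := hasDerivAt_pi.1
      (hd.hasLineDerivAt ((0 : B.Coord × B.Coord), (Pi.single l (1 : ℝ)))) j
    have h2 : DifferentiableAt ℝ (fun w => T.lhs i j w v) z := by
      have h3 : ContDiffOn ℝ ∞ (fun w => T.lhs i j w v) Z :=
        (T.contDiffOn_lhs i j).comp (contDiff_id.prodMk contDiff_const).contDiffOn
          fun w hw => ⟨hw, mem_univ _⟩
      exact (h3.contDiffAt (hZ.mem_nhds hz)).differentiableAt (by simp)
    have h4 := h2.hasFDerivAt.hasLineDerivAt (Pi.single (⟨i.succ, Sum.inr l⟩ : B.Index) 1)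
    have h5 : (fun t : ℝ => T.blockMap i (((z, v), hat i z) +
        t • ((0 : B.Coord × B.Coord), (Pi.single l (1 : ℝ)))) j) =
        fun t : ℝ => T.lhs i j (z + t • Pi.single (⟨i.succ, Sum.inr l⟩ : B.Index) 1) v := by
      funext t
      rw [← setHat_hat_add_smul_single]
      simp [TriangularEquations.blockMap]
    have h6 : HasDerivAt (fun t : ℝ => T.blockMap i (((z, v), hat i z) +
        t • ((0 : B.Coord × B.Coord), (Pi.single l (1 : ℝ)))) j) _ 0 := h1
    rw [h5] at h6
    have h7 := h6.unique h4
    simp only [TriangularEquations.jacobian, Matrix.of_apply]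
    rw [← h7]
    simp [hA]
  have hne : A.det ≠ 0 := by
    rw [← hmat, LinearMap.det_toMatrix'] at hdet
    exact hdet
  exact ⟨A.toContinuousLinearEquivOfDetNeZero hne, rfl⟩

end Triangular

/-! ### Solving the triangular equations for `z` in terms of the derivatives of `y` -/

section Param

variable {nx nu : ℕ} {B : BlockPartition}

/-- The output `y` read as a function of `(x, u)` through `φ`. -/
def yOutput (φ : OpenPartialHomeomorph B.Coord (StateInput nx nu)) :
    StateInput nx nu → B.YIndex → ℝ := fun p => B.yPart (φ.symm p)

/-- The derivative of a coordinate-valued function of sequences along the shift. -/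
def shiftVelocity (g : (ℕ → B.YIndex → ℝ) → B.Coord) (Y : ℕ → B.YIndex → ℝ) : B.Coord :=
  fun κ => derivAlong seqShift (fun Y => g Y κ) Y

/-- The velocity `ż` of the `z`-coordinates at a jet. -/
def zVelocity (f : StateInput nx nu → Fin nx → ℝ)
    (φ : OpenPartialHomeomorph B.Coord (StateInput nx nu)) (ξ : Jet nx nu) : B.Coord :=
  fderiv ℝ φ.symm (Jet.base ξ) (f (Jet.base ξ), ξ.2 1)

variable {f : StateInput nx nu → Fin nx → ℝ}
  {φ : OpenPartialHomeomorph B.Coord (StateInput nx nu)}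

theorem contDiffOn_yOutput (hφsymm : ContDiffOn ℝ ∞ φ.symm φ.target) :
    ContDiffOn ℝ ∞ (yOutput φ) φ.target :=
  contDiffOn_pi.2 fun p => contDiffOn_pi.1 hφsymm ⟨p.1, Sum.inl p.2⟩

theorem cylSmoothAt_clm_seqShift {X : Type} [NormedAddCommGroup X] [NormedSpace ℝ X]
    (Y : ℕ → X) (E : Type) [NormedAddCommGroup E] [NormedSpace ℝ E] (L : (ℕ → X) →L[ℝ] E) :
    CylSmoothAt (fun Y => L (seqShift Y)) Y :=
  CylSmoothAt.clm (L.comp seqShift) Y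

theorem CylSmoothAt.shiftVelocity {g : (ℕ → B.YIndex → ℝ) → B.Coord} {Y : ℕ → B.YIndex → ℝ}
    (hg : CylSmoothAt g Y) : CylSmoothAt (shiftVelocity g) Y :=
  CylSmoothAt.pi fun κ => (hg.apply κ).derivAlong (cylSmoothAt_clm_seqShift Y)

theorem CylSmoothAt.hasDerivAt_shiftVelocity {g : (ℕ → B.YIndex → ℝ) → B.Coord}
    {Y : ℕ → B.YIndex → ℝ} (hg : CylSmoothAt g Y) :
    HasDerivAt (fun t : ℝ => g (Y + t • seqShift Y)) (ControlFlat.shiftVelocity g Y) 0 :=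
  hasDerivAt_pi.2 fun κ => (hg.apply κ).hasLineDerivAt (seqShift Y)

theorem hasVelocity_base_cartanField (ξ : Jet nx nu) :
    HasDerivAt (fun t : ℝ => Jet.base (ξ + t • cartanField f ξ)) (f (Jet.base ξ), ξ.2 1) 0 :=
  (hasVelocity_line ξ (cartanField f ξ)).clm (baseCLM nx nu)

theorem hasDerivAt_symm_base (hφsymm : ContDiffOn ℝ ∞ φ.symm φ.target) {ξ : Jet nx nu}
    (hξ : Jet.base ξ ∈ φ.target) :
    HasDerivAt (fun t : ℝ => φ.symm (Jet.base (ξ + t • cartanField f ξ))) (zVelocity f φ ξ) 0 := by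
  have h1 : HasFDerivAt φ.symm (fderiv ℝ φ.symm (Jet.base ξ))
      (Jet.base (ξ + (0 : ℝ) • cartanField f ξ)) := by
    simpa using ((hφsymm.contDiffAt (φ.open_target.mem_nhds hξ)).differentiableAt
      (by simp)).hasFDerivAt
  exact h1.comp_hasDerivAt (0 : ℝ) (hasVelocity_base_cartanField ξ)

theorem fderiv_zVelocity (hφ : ContDiffOn ℝ ∞ φ φ.source)
    (hφsymm : ContDiffOn ℝ ∞ φ.symm φ.target) {ξ : Jet nx nu} (hξ : Jet.base ξ ∈ φ.target) :
    fderiv ℝ φ (φ.symm (Jet.base ξ)) (zVelocity f φ ξ) = (f (Jet.base ξ), ξ.2 1) := by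
  have h1 := ((hφ.contDiffAt (φ.open_source.mem_nhds (φ.map_target hξ))).differentiableAt
    (by simp)).hasFDerivAt
  have h2 := ((hφsymm.contDiffAt (φ.open_target.mem_nhds hξ)).differentiableAt
      (by simp)).hasFDerivAt
  have h3 := h1.comp _ h2
  have h4 : HasFDerivAt (φ ∘ φ.symm) (ContinuousLinearMap.id ℝ (StateInput nx nu))
      (Jet.base ξ) := by
    refine (hasFDerivAt_id _).congr_of_eventuallyEq ?_
    filter_upwards [φ.open_target.mem_nhds hξ] with p hp
    exact φ.right_inv hp
  have h5 := h3.unique h4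
  exact congrArg (fun A : StateInput nx nu →L[ℝ] StateInput nx nu => A (f (Jet.base ξ), ξ.2 1)) h5

theorem lhs_zVelocity (hφ : ContDiffOn ℝ ∞ φ φ.source)
    (hφsymm : ContDiffOn ℝ ∞ φ.symm φ.target) {T : TriangularEquations B φ.source}
    (hT : Represents T φ f) {ξ : Jet nx nu} (hξ : Jet.base ξ ∈ φ.target) (i : Fin B.nb)
    (j : Fin (B.nh i.succ)) : T.lhs i j (φ.symm (Jet.base ξ)) (zVelocity f φ ξ) = 0 := by
  refine (hT _ (φ.map_target hξ) _).2 ?_ i j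
  rw [fderiv_zVelocity hφ hφsymm hξ, φ.right_inv hξ]

/-- `g` expresses the coordinates of the first `n + 1` blocks along the trajectories through the
time derivatives of `y`, and solves the first `n` blocks of equations for arbitrary `y`. -/
structure IsPartialParam (f : StateInput nx nu → Fin nx → ℝ)
    (φ : OpenPartialHomeomorph B.Coord (StateInput nx nu)) (T : TriangularEquations B φ.source)
    (ξ₀ : Jet nx nu) (n : ℕ) (g : (ℕ → B.YIndex → ℝ) → B.Coord) : Prop where
  smooth : CylSmoothAt g (outputJet f (yOutput φ) ξ₀)
  base : g (outputJet f (yOutput φ) ξ₀) = φ.symm (Jet.base ξ₀)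
  inl : ∀ Y p, B.yPart (g Y) p = Y 0 p
  agrees : ∀ᶠ ξ in 𝓝 ξ₀, ∀ κ : B.Index, κ.1.val ≤ n →
    g (outputJet f (yOutput φ) ξ) κ = φ.symm (Jet.base ξ) κ
  solves : ∀ᶠ Y in 𝓝 (outputJet f (yOutput φ) ξ₀), ∀ i : Fin B.nb, i.val < n →
    ∀ j, T.lhs i j (g Y) (shiftVelocity g Y) = 0

theorem exists_isPartialParam_zero (T : TriangularEquations B φ.source) (ξ₀ : Jet nx nu) :
    ∃ g, IsPartialParam f φ T ξ₀ 0 g := by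
  -- All `y`-coordinates, including those of later blocks, are right from the start. The
  -- `ẑ`-coordinates are frozen at their values at `ξ₀` until their equations are solved; this keeps
  -- the base point equal to `z₀`.
  refine ⟨fun Y κ => match κ with
    | ⟨i, Sum.inl l⟩ => Y 0 ⟨i, l⟩
    | ⟨i, Sum.inr l⟩ => φ.symm (Jet.base ξ₀) ⟨i, Sum.inr l⟩, ?_, ?_, ?_, ?_, ?_⟩
  · refine CylSmoothAt.pi fun κ => ?_
    obtain ⟨i, l | l⟩ := κ
    · exact CylSmoothAt.clm ((ContinuousLinearMap.proj (R := ℝ) (φ := fun _ : B.YIndex => ℝ)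
        ⟨i, l⟩).comp (ContinuousLinearMap.proj (R := ℝ) (φ := fun _ : ℕ => B.YIndex → ℝ) 0)) _
    · exact CylSmoothAt.const _ _
  · funext κ
    obtain ⟨i, l | l⟩ := κ <;> rfl
  · intro Y p
    rfl
  · refine Eventually.of_forall fun ξ κ hκ => ?_
    obtain ⟨i, l | l⟩ := κ
    · rfl
    · have hi : i = 0 := Fin.ext (Nat.le_zero.1 hκ)
      subst hi
      exact absurd l.2 (by simp [B.nh_first])
  · exact Eventually.of_forall fun Y i hi => absurd hi (Nat.not_lt_zero _)

/-- The identity `agrees` holds on an open set of jets, so it may be differentiated along the Cartan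
field. -/
theorem IsPartialParam.eventually_shiftVelocity (hf : ContDiffOn ℝ ∞ f φ.target)
    (hφsymm : ContDiffOn ℝ ∞ φ.symm φ.target) {T : TriangularEquations B φ.source}
    {ξ₀ : Jet nx nu} (hξ₀ : Jet.base ξ₀ ∈ φ.target) {n : ℕ}
    {g : (ℕ → B.YIndex → ℝ) → B.Coord} (hg : IsPartialParam f φ T ξ₀ n g) :
    ∀ᶠ ξ in 𝓝 ξ₀, ∀ κ : B.Index, κ.1.val ≤ n →
      shiftVelocity g (outputJet f (yOutput φ) ξ) κ = zVelocity f φ ξ κ := by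
  have hh := contDiffOn_yOutput hφsymm
  have hπ := continuousAt_outputJet φ.open_target hf hh hξ₀
  filter_upwards [hg.agrees.eventually_nhds, hπ.eventually hg.smooth.eventually,
    continuous_base.continuousAt.eventually (φ.open_target.mem_nhds hξ₀)] with ξ h1 h2 h3 κ hκ
  have h4 := hasDerivAt_comp_outputJet φ.open_target hf hh h3 (h2.apply κ)
  have h5 := hasDerivAt_pi.1 (hasDerivAt_symm_base (f := f) hφsymm h3) κ
  refine h4.unique (h5.congr_of_eventuallyEq ?_)
  filter_upwards [(tendsto_line ξ (cartanField f ξ)).eventually h1] with t ht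
  exact ht κ hκ

theorem IsPartialParam.exists_succ (hf : ContDiffOn ℝ ∞ f φ.target)
    (hφ : ContDiffOn ℝ ∞ φ φ.source)
    (hφsymm : ContDiffOn ℝ ∞ φ.symm φ.target) {T : TriangularEquations B φ.source}
    (hT : Represents T φ f) {ξ₀ : Jet nx nu} (hξ₀ : Jet.base ξ₀ ∈ φ.target)
    (hreg : T.RegularAt (φ.symm (Jet.base ξ₀)) (zVelocity f φ ξ₀)) (i : Fin B.nb)
    {g : (ℕ → B.YIndex → ℝ) → B.Coord} (hg : IsPartialParam f φ T ξ₀ i.val g) :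
    ∃ g', IsPartialParam f φ T ξ₀ (i.val + 1) g' := by
  have hh := contDiffOn_yOutput hφsymm
  have hπ := continuousAt_outputJet φ.open_target hf hh hξ₀
  have hsrc := φ.map_target hξ₀
  set z₀ := φ.symm (Jet.base ξ₀) with hz₀
  set Y₀ := outputJet f (yOutput φ) ξ₀ with hY₀
  have hvel := hg.eventually_shiftVelocity hf hφsymm hξ₀
  have hle : ∀ {κ : B.Index}, κ.1 ≤ i.castSucc → κ.1.val ≤ i.val := fun h => h
  have hv₀ : ∀ κ : B.Index, κ.1 ≤ i.castSucc → shiftVelocity g Y₀ κ = zVelocity f φ ξ₀ κ :=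
    fun κ hκ => hvel.self_of_nhds κ (hle hκ)
  -- The velocity of `g` is wrong on unsolved blocks, but block `i` of the equations sees only the
  -- velocities of blocks already solved.
  have hdet : (T.jacobian i z₀ (shiftVelocity g Y₀)).det ≠ 0 := by
    have : T.jacobian i z₀ (shiftVelocity g Y₀) = T.jacobian i z₀ (zVelocity f φ ξ₀) := by
      ext j l
      simp only [TriangularEquations.jacobian, Matrix.of_apply,
        fun w => T.lhs_congr_velocity j w hv₀]
    rw [this]
    exact hreg i
  have hzero : T.blockMap i ((z₀, shiftVelocity g Y₀), hat i z₀) = 0 := by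
    funext j
    simp only [TriangularEquations.blockMap, setHat_hat]
    rw [T.lhs_congr_velocity j z₀ hv₀]
    exact lhs_zVelocity hφ hφsymm hT hξ₀ i j
  obtain ⟨A, ψ, hA, hp₀, hψ, hψ₀, hψz, hψu⟩ := exists_contDiffOn_implicit
    (isOpen_blockDomain φ.open_source i) (T.contDiffOn_blockMap i)
    (by simpa [blockDomain] using hsrc) hzero
    (T.isInvertible_fderiv_blockMap φ.open_source i hsrc hdet)
  have hpair : CylSmoothAt (fun Y => (g Y, shiftVelocity g Y)) Y₀ :=
    hg.smooth.prodMk hg.smooth.shiftVelocity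
  have hp₀' : (g Y₀, shiftVelocity g Y₀) ∈ A := by rw [hg.base]; exact hp₀
  have hψg : CylSmoothAt (fun Y => ψ (g Y, shiftVelocity g Y)) Y₀ := hpair.comp hA hψ hp₀'
  have hg's : CylSmoothAt (fun Y => setHat i (g Y) (ψ (g Y, shiftVelocity g Y))) Y₀ :=
    (hg.smooth.prodMk hψg).comp_contDiff (contDiff_setHat i)
  set g' : (ℕ → B.YIndex → ℝ) → B.Coord :=
    fun Y => setHat i (g Y) (ψ (g Y, shiftVelocity g Y)) with hg'
  have hbase' : g' Y₀ = z₀ := by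
    simp only [hg']
    rw [hg.base, hψ₀, setHat_hat]
  have hsame : ∀ κ : B.Index, κ.1 ≤ i.castSucc → ∀ Y, g' Y κ = g Y κ :=
    fun κ hκ Y => setHat_of_le _ _ hκ
  have hsamev : ∀ κ : B.Index, κ.1 ≤ i.castSucc → ∀ Y,
      shiftVelocity g' Y κ = shiftVelocity g Y κ := fun κ hκ Y => by
    simp only [shiftVelocity, hsame κ hκ]
  refine ⟨g', hg's, hbase', fun Y p => ?_, ?_, ?_⟩
  · rw [← hg.inl Y p]
    obtain ⟨k, l'⟩ := p
    refine setHat_of_ne _ _ fun l hl => ?_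
    obtain ⟨rfl, hl⟩ := Sigma.mk.inj hl
    exact Sum.inl_ne_inr (eq_of_heq hl)
  -- The true `ẑ^{i+1}` also solves the `i`-th block of equations with the data supplied by `g`, so
  -- the uniqueness part of the implicit function theorem forces it to be `ψ`.
  · have hz : ContinuousAt (fun ξ : Jet nx nu => φ.symm (Jet.base ξ)) ξ₀ :=
      (φ.continuousAt_symm hξ₀).comp continuous_base.continuousAt
    have hq : ContinuousAt (fun ξ : Jet nx nu =>
        (((g (outputJet f (yOutput φ) ξ), shiftVelocity g (outputJet f (yOutput φ) ξ)),
          hat i (φ.symm (Jet.base ξ))) :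
            (B.Coord × B.Coord) × (Fin (B.nh i.succ) → ℝ))) ξ₀ := by
      refine (hpair.continuousAt.comp (f := outputJet f (yOutput φ)) hπ).prodMk ?_
      exact continuousAt_pi.2 fun l => continuousAt_pi.1 hz _
    have hq₀ : ((g (outputJet f (yOutput φ) ξ₀), shiftVelocity g (outputJet f (yOutput φ) ξ₀)),
          hat i (φ.symm (Jet.base ξ₀))) = ((z₀, shiftVelocity g Y₀), hat i z₀) := by
      rw [← hY₀, hg.base]
    have hdom : blockDomain φ.source i ∈ 𝓝 ((z₀, shiftVelocity g Y₀), hat i z₀) :=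
      (isOpen_blockDomain φ.open_source i).mem_nhds (by simpa [blockDomain] using hsrc)
    rw [ContinuousAt, hq₀] at hq
    filter_upwards [hg.agrees, hvel, hq.eventually hψu, hq.eventually hdom,
      continuous_base.continuousAt.eventually (φ.open_target.mem_nhds hξ₀)]
      with ξ h1 h2 h3 h4 h5 κ hκ
    by_cases hex : ∃ l, κ = ⟨i.succ, Sum.inr l⟩
    · obtain ⟨l, rfl⟩ := hex
      have h6 : T.blockMap i ((g (outputJet f (yOutput φ) ξ),
          shiftVelocity g (outputJet f (yOutput φ) ξ)), hat i (φ.symm (Jet.base ξ))) = 0 := by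
        funext j
        refine Eq.trans ?_ (lhs_zVelocity hφ hφsymm hT h5 i j)
        -- The two points may differ in later blocks and in `y^{i+1}`, on which the coefficients do
        -- not depend; `h4` guarantees that the mixed point lies in the domain where that
        -- independence is known.
        refine T.lhs_congr j h4 (φ.map_target h5) (fun κ hκ => ?_) fun κ hκ => h2 κ (hle hκ)
        obtain ⟨k, l | l⟩ := κ
        · have hk : k ≤ i.castSucc := hκ
          exact (setHat_of_le _ _ hk).trans (h1 _ hk)
        · rcases eq_or_lt_of_le (show k ≤ i.succ from hκ) with rfl | hlt
          · exact setHat_apply _ _ _ _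
          · have hk : k ≤ i.castSucc := Fin.le_castSucc_iff.2 hlt
            exact (setHat_of_le _ _ hk).trans (h1 _ hk)
      have h7 := h3 h6
      simp only [hg', setHat_apply]
      exact (congrFun h7 l).symm
    · have hκ' : κ.1.val ≤ i.val ∨ κ.1 = i.succ := by
        rcases Nat.lt_or_ge i.val κ.1.val with h | h
        · exact Or.inr (Fin.ext (le_antisymm hκ h))
        · exact Or.inl h
      push Not at hex
      obtain hκ' | hκ' := hκ'
      · rw [hsame κ hκ']
        exact h1 κ hκ'
      · obtain ⟨k, l | l⟩ := κ
        · exact (setHat_of_ne _ _ hex).trans (hg.inl _ ⟨k, l⟩)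
        · simp only at hκ'
          subst hκ'
          exact absurd rfl (hex l)
  · have hgs : ∀ᶠ Y in 𝓝 Y₀, g Y ∈ φ.source :=
      hg.smooth.continuousAt.eventually (φ.open_source.mem_nhds (by rwa [hg.base]))
    have hg's : ∀ᶠ Y in 𝓝 Y₀, g' Y ∈ φ.source :=
      hg's.continuousAt.eventually (φ.open_source.mem_nhds (by rwa [hbase']))
    filter_upwards [hg.solves, hgs, hg's, hpair.continuousAt.eventually (hA.mem_nhds hp₀')]
      with Y h1 h2 h3 h4 i' hi' j
    rcases Nat.lt_succ_iff_lt_or_eq.1 hi' with hlt | heq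
    -- Earlier equations involve blocks up to `i' + 1 ≤ i` only, so replacing `ẑ` in block `i + 1`
    -- leaves them solved.
    · have hle' : ∀ {k : Fin (B.nb + 1)}, k ≤ i'.succ → k ≤ i.castSucc := fun {k} hk =>
        hk.trans (show i'.val + 1 ≤ i.val from hlt)
      rw [← h1 i' hlt j]
      refine T.lhs_congr j h3 h2 (fun κ hκ => ?_) fun κ hκ =>
        hsamev κ (hle' (hκ.trans i'.castSucc_lt_succ.le)) Y
      obtain ⟨k, l | l⟩ := κ
      · exact hsame _ (hle' (le_trans (show k ≤ i'.castSucc from hκ) i'.castSucc_lt_succ.le)) Y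
      · exact hsame _ (hle' (show k ≤ i'.succ from hκ)) Y
    · obtain rfl : i' = i := Fin.ext heq
      rw [T.lhs_congr_velocity j _ fun κ hκ => hsamev κ hκ Y]
      exact congrFun (hψz _ h4) j

theorem exists_isPartialParam (hf : ContDiffOn ℝ ∞ f φ.target)
    (hφ : ContDiffOn ℝ ∞ φ φ.source)
    (hφsymm : ContDiffOn ℝ ∞ φ.symm φ.target) {T : TriangularEquations B φ.source}
    (hT : Represents T φ f) {ξ₀ : Jet nx nu} (hξ₀ : Jet.base ξ₀ ∈ φ.target)
    (hreg : T.RegularAt (φ.symm (Jet.base ξ₀)) (zVelocity f φ ξ₀)) (n : ℕ) (hn : n ≤ B.nb) :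
    ∃ g, IsPartialParam f φ T ξ₀ n g := by
  induction n with
  | zero => exact exists_isPartialParam_zero T ξ₀
  | succ n ih =>
    obtain ⟨g, hg⟩ := ih (by omega)
    exact hg.exists_succ hf hφ hφsymm hT hξ₀ hreg ⟨n, hn⟩

end Param

/-- Needed because `IsOneFlatAt` numbers the outputs by `Fin nu`, whereas `y` is indexed by blocks.
-/
theorem IsFlatOutputAt.reindex {nx nu : ℕ} {ι ι' : Type} [Fintype ι] [Fintype ι']
    {f : StateInput nx nu → Fin nx → ℝ} {h : StateInput nx nu → ι → ℝ} {ξ₀ : Jet nx nu}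
    (hh : IsFlatOutputAt f h ξ₀) (e : ι' ≃ ι) : IsFlatOutputAt f (fun p i => h p (e i)) ξ₀ := by
  obtain ⟨hc, ⟨W, hW, hW₀, hs⟩, N, hN, hN₀, hind, r, V, F, hV, hF, hFV⟩ := hh
  refine ⟨by rw [Fintype.card_congr e, hc], ⟨W, hW, hW₀, ?_⟩, N, hN, hN₀, fun ξ hξ => ?_, r, ?_⟩
  · exact contDiffOn_pi.2 fun i => contDiffOn_pi.1 hs (e i)
  · exact (hind ξ hξ).comp (Prod.map id e) (Function.injective_id.prodMap e.injective)
  · have hR : ContDiff ℝ ∞ fun (y : Fin (r + 1) → ι' → ℝ) k i => y k (e.symm i) :=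
      contDiff_pi.2 fun k => contDiff_pi.2 fun i =>
        (contDiff_apply ℝ ℝ (e.symm i)).comp (contDiff_apply ℝ (ι' → ℝ) k)
    refine ⟨(fun y k i => y k (e.symm i)) ⁻¹' V, fun y => F fun k i => y k (e.symm i),
      hV.preimage hR.continuous, hF.comp hR.contDiffOn fun y hy => hy, fun ξ hξ => ?_⟩
    have h1 : (fun (k : Fin (r + 1)) (i : ι) =>
        outputDeriv f (fun p i => h p (e i)) k (e.symm i) ξ) =
        fun (k : Fin (r + 1)) (i : ι) => outputDeriv f h k i ξ := by
      funext k i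
      change outputDeriv f h k (e (e.symm i)) ξ = _
      rw [e.apply_symm_apply]
    simp only [mem_preimage, h1]
    exact hFV ξ hξ

/-! ### Lifting output sequences back to jets, and flatness -/

section Lift

variable {nx nu : ℕ} {B : BlockPartition} {f : StateInput nx nu → Fin nx → ℝ}
  {φ : OpenPartialHomeomorph B.Coord (StateInput nx nu)}

/-- The time derivatives of the input as functions of the time derivatives of `y`. -/
def inputDeriv (φ : OpenPartialHomeomorph B.Coord (StateInput nx nu))
    (g : (ℕ → B.YIndex → ℝ) → B.Coord) (k : ℕ) (j : Fin nu) : (ℕ → B.YIndex → ℝ) → ℝ :=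
  (derivAlong seqShift)^[k] fun Y => (φ (g Y)).2 j

/-- The jet with prescribed time derivatives of `y`. -/
def jetOfOutput (φ : OpenPartialHomeomorph B.Coord (StateInput nx nu))
    (g : (ℕ → B.YIndex → ℝ) → B.Coord) (Y : ℕ → B.YIndex → ℝ) : Jet nx nu :=
  ((φ (g Y)).1, fun k j => inputDeriv φ g k j Y)

/-- The differential of `jetOfOutput`. -/
def jetOfOutputDeriv (φ : OpenPartialHomeomorph B.Coord (StateInput nx nu))
    (g : (ℕ → B.YIndex → ℝ) → B.Coord) (Y V : ℕ → B.YIndex → ℝ) : Jet nx nu :=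
  (lineDeriv ℝ (fun Y => (φ (g Y)).1) Y V, fun k j => lineDeriv ℝ (inputDeriv φ g k j) Y V)

/-- On `M`, the function `g` gives smooth coordinates `z` in the domain of `φ` which have the
prescribed `y` and whose velocity solves the equations. -/
structure IsParam (φ : OpenPartialHomeomorph B.Coord (StateInput nx nu))
    (T : TriangularEquations B φ.source) (M : Set (ℕ → B.YIndex → ℝ))
    (g : (ℕ → B.YIndex → ℝ) → B.Coord) : Prop where
  isOpen : IsOpen M
  smooth : ∀ Y ∈ M, CylSmoothAt g Y
  mem_source : ∀ Y ∈ M, g Y ∈ φ.source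
  yPart_eq : ∀ Y ∈ M, ∀ p, B.yPart (g Y) p = Y 0 p
  solves : ∀ Y ∈ M, ∀ i j, T.lhs i j (g Y) (shiftVelocity g Y) = 0

variable {T : TriangularEquations B φ.source} {M : Set (ℕ → B.YIndex → ℝ)}
  {g : (ℕ → B.YIndex → ℝ) → B.Coord}

theorem base_jetOfOutput (Y : ℕ → B.YIndex → ℝ) : Jet.base (jetOfOutput φ g Y) = φ (g Y) := rfl

theorem inputDeriv_succ (k : ℕ) (j : Fin nu) :
    inputDeriv φ g (k + 1) j = derivAlong seqShift (inputDeriv φ g k j) := by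
  unfold inputDeriv
  rw [Function.iterate_succ_apply']

namespace IsParam

theorem cylSmoothAt_comp (hg : IsParam φ T M g) (hφ : ContDiffOn ℝ ∞ φ φ.source)
    {Y : ℕ → B.YIndex → ℝ} (hY : Y ∈ M) : CylSmoothAt (fun Y => φ (g Y)) Y :=
  (hg.smooth Y hY).comp φ.open_source hφ (hg.mem_source Y hY)

theorem cylSmoothAt_inputDeriv (hg : IsParam φ T M g) (hφ : ContDiffOn ℝ ∞ φ φ.source) (k : ℕ)
    (j : Fin nu) {Y : ℕ → B.YIndex → ℝ} (hY : Y ∈ M) : CylSmoothAt (inputDeriv φ g k j) Y := by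
  induction k with
  | zero => exact ((hg.cylSmoothAt_comp hφ hY).comp_contDiff contDiff_snd).apply j
  | succ k ih =>
    rw [inputDeriv_succ]
    exact ih.derivAlong (cylSmoothAt_clm_seqShift Y)

theorem hasVelocity_jetOfOutput (hg : IsParam φ T M g) (hφ : ContDiffOn ℝ ∞ φ φ.source)
    {Y : ℕ → B.YIndex → ℝ} (hY : Y ∈ M) (V : ℕ → B.YIndex → ℝ) :
    HasVelocity (fun t : ℝ => jetOfOutput φ g (Y + t • V)) (jetOfOutputDeriv φ g Y V) := by
  refine HasVelocity.prodMk (hasVelocity_iff_hasDerivAt.2 ?_)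
    (hasVelocity_pi.2 fun k => hasDerivAt_pi.2 fun j => ?_)
  · exact ((hg.cylSmoothAt_comp hφ hY).comp_contDiff contDiff_fst).hasLineDerivAt V
  · exact (hg.cylSmoothAt_inputDeriv hφ k j hY).hasLineDerivAt V

/-- The state component is where the equations turn into the dynamics, through `Represents`; the
input components agree by the recursive definition of `inputDeriv`. -/
theorem jetOfOutputDeriv_seqShift (hg : IsParam φ T M g) (hφ : ContDiffOn ℝ ∞ φ φ.source)
    (hT : Represents T φ f) {Y : ℕ → B.YIndex → ℝ} (hY : Y ∈ M) :
    jetOfOutputDeriv φ g Y (seqShift Y) = cartanField f (jetOfOutput φ g Y) := by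
  refine Prod.ext ?_ ?_
  · have h1 : HasFDerivAt φ (fderiv ℝ φ (g Y)) (g (Y + (0 : ℝ) • seqShift Y)) := by
      simpa using ((hφ.contDiffAt (φ.open_source.mem_nhds (hg.mem_source Y hY))).differentiableAt
        (by simp)).hasFDerivAt
    have h2 := h1.comp_hasDerivAt (0 : ℝ) (hg.smooth Y hY).hasDerivAt_shiftVelocity
    have h3 : HasLineDerivAt ℝ (fun Y => (φ (g Y)).1)
        (fderiv ℝ φ (g Y) (shiftVelocity g Y)).1 Y (seqShift Y) :=
      (ContinuousLinearMap.fst ℝ (Fin nx → ℝ) (Fin nu → ℝ)).hasFDerivAt.comp_hasDerivAt (0 : ℝ) h2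
    exact h3.lineDeriv.trans ((hT _ (hg.mem_source Y hY) _).1 (hg.solves Y hY))
  · funext k j
    exact (congrFun (inputDeriv_succ k j) Y).symm

/-- The identity for `k` on the open set `M` is differentiated along the shift, which `jetOfOutput`
carries to the Cartan field. Keeping `M` fixed makes all orders hold on one set. -/
theorem outputDeriv_jetOfOutput (hg : IsParam φ T M g) (hf : ContDiffOn ℝ ∞ f φ.target)
    (hφ : ContDiffOn ℝ ∞ φ φ.source) (hφsymm : ContDiffOn ℝ ∞ φ.symm φ.target)
    (hT : Represents T φ f) (k : ℕ) (p : B.YIndex) {Y : ℕ → B.YIndex → ℝ} (hY : Y ∈ M) :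
    outputDeriv f (yOutput φ) k p (jetOfOutput φ g Y) = Y k p := by
  induction k generalizing Y with
  | zero =>
    rw [outputDeriv_zero, base_jetOfOutput, yOutput, φ.left_inv (hg.mem_source Y hY),
      hg.yPart_eq Y hY]
  | succ k ih =>
    have h1 := (cylSmoothAt_outputDeriv φ.open_target hf (contDiffOn_yOutput hφsymm) k p
      (ξ := jetOfOutput φ g Y) (φ.map_source (hg.mem_source Y hY))).hasDerivAt_comp_of_eq
      (hg.hasVelocity_jetOfOutput hφ hY (seqShift Y)) (by simp)
    rw [hg.jetOfOutputDeriv_seqShift hφ hT hY] at h1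
    rw [outputDeriv_succ]
    have h2 : HasDerivAt (fun t : ℝ => (Y + t • seqShift Y) k p) (Y (k + 1) p) 0 :=
      hasDerivAt_pi.1 (hasVelocity_pi.1 (hasVelocity_line Y (seqShift Y)) k) p
    refine h1.unique (h2.congr_of_eventuallyEq ?_)
    filter_upwards [(tendsto_line Y (seqShift Y)).eventually (hg.isOpen.mem_nhds hY)] with t ht
    exact ih ht

theorem lineDeriv_outputDeriv (hg : IsParam φ T M g) (hf : ContDiffOn ℝ ∞ f φ.target)
    (hφ : ContDiffOn ℝ ∞ φ φ.source) (hφsymm : ContDiffOn ℝ ∞ φ.symm φ.target)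
    (hT : Represents T φ f) (k : ℕ) (p : B.YIndex) {Y : ℕ → B.YIndex → ℝ} (hY : Y ∈ M)
    (V : ℕ → B.YIndex → ℝ) :
    lineDeriv ℝ (outputDeriv f (yOutput φ) k p) (jetOfOutput φ g Y) (jetOfOutputDeriv φ g Y V) =
      V k p := by
  have h1 := (cylSmoothAt_outputDeriv φ.open_target hf (contDiffOn_yOutput hφsymm) k p
    (ξ := jetOfOutput φ g Y) (φ.map_source (hg.mem_source Y hY))).hasDerivAt_comp_of_eq
    (hg.hasVelocity_jetOfOutput hφ hY V) (by simp)
  have h2 : HasDerivAt (fun t : ℝ => (Y + t • V) k p) (V k p) 0 :=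
    hasDerivAt_pi.1 (hasVelocity_pi.1 (hasVelocity_line Y V) k) p
  refine h1.unique (h2.congr_of_eventuallyEq ?_)
  filter_upwards [(tendsto_line Y V).eventually (hg.isOpen.mem_nhds hY)] with t ht
  exact hg.outputDeriv_jetOfOutput hf hφ hφsymm hT k p ht

theorem differentiallyIndependentAt (hg : IsParam φ T M g) (hf : ContDiffOn ℝ ∞ f φ.target)
    (hφ : ContDiffOn ℝ ∞ φ φ.source) (hφsymm : ContDiffOn ℝ ∞ φ.symm φ.target)
    (hT : Represents T φ f) {Y : ℕ → B.YIndex → ℝ} (hY : Y ∈ M) :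
    DifferentiallyIndependentAt f (yOutput φ) (jetOfOutput φ g Y) := by
  classical
  -- Pulled back along the differential of `jetOfOutput`, the family becomes the coordinate
  -- functionals `V ↦ V k p`; indicator sequences isolate each coefficient.
  refine LinearIndependent.of_comp (LinearMap.funLeft ℝ ℝ (jetOfOutputDeriv φ g Y)) ?_
  refine linearIndependent_iff'.2 fun s c hc q hq => ?_
  have h1 := congrFun hc fun k p => if (k, p) = q then 1 else 0
  simp only [Finset.sum_apply, Pi.smul_apply, Function.comp_apply, LinearMap.funLeft_apply,
    hg.lineDeriv_outputDeriv hf hφ hφsymm hT _ _ hY] at h1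
  simpa [hq] using h1

/-- Recovering `u` from the output jet on an open `N` and differentiating along the Cartan field
recovers each further derivative of `u`, without shrinking `N`. -/
theorem inputDeriv_outputJet (hg : IsParam φ T M g) (hf : ContDiffOn ℝ ∞ f φ.target)
    (hφ : ContDiffOn ℝ ∞ φ φ.source) (hφsymm : ContDiffOn ℝ ∞ φ.symm φ.target)
    {N : Set (Jet nx nu)} (hN : IsOpen N)
    (hNt : ∀ ξ ∈ N, Jet.base ξ ∈ φ.target) (hNM : ∀ ξ ∈ N, outputJet f (yOutput φ) ξ ∈ M)
    (hgN : ∀ ξ ∈ N, g (outputJet f (yOutput φ) ξ) = φ.symm (Jet.base ξ)) (k : ℕ) (j : Fin nu)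
    {ξ : Jet nx nu} (hξ : ξ ∈ N) :
    inputDeriv φ g k j (outputJet f (yOutput φ) ξ) = ξ.2 k j := by
  induction k generalizing ξ with
  | zero =>
    change (φ (g (outputJet f (yOutput φ) ξ))).2 j = _
    rw [hgN ξ hξ, φ.right_inv (hNt ξ hξ)]
    rfl
  | succ k ih =>
    rw [inputDeriv_succ]
    have h1 := hasDerivAt_comp_outputJet φ.open_target hf (contDiffOn_yOutput hφsymm) (hNt ξ hξ)
      (hg.cylSmoothAt_inputDeriv hφ k j (hNM ξ hξ))
    have h2 : HasDerivAt (fun t : ℝ => (ξ + t • cartanField f ξ).2 k j) (ξ.2 (k + 1) j) 0 :=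
      hasDerivAt_pi.1 ((hasVelocity_line ξ (cartanField f ξ)).clm
        ((ContinuousLinearMap.proj (R := ℝ) (φ := fun _ : ℕ => Fin nu → ℝ) k).comp
          (ContinuousLinearMap.snd ℝ (Fin nx → ℝ) (ℕ → Fin nu → ℝ)))) j
    refine h1.unique (h2.congr_of_eventuallyEq ?_)
    filter_upwards [(tendsto_line ξ (cartanField f ξ)).eventually (hN.mem_nhds hξ)] with t ht
    exact ih ht

end IsParam

theorem isFlatOutputAt_yOutput (hcard : Fintype.card B.YIndex = nu)
    (hf : ContDiffOn ℝ ∞ f φ.target)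
    (hφ : ContDiffOn ℝ ∞ φ φ.source) (hφsymm : ContDiffOn ℝ ∞ φ.symm φ.target)
    (hT : Represents T φ f) {ξ₀ : Jet nx nu} (hξ₀ : Jet.base ξ₀ ∈ φ.target)
    (hreg : T.RegularAt (φ.symm (Jet.base ξ₀)) (zVelocity f φ ξ₀)) :
    IsFlatOutputAt f (yOutput φ) ξ₀ := by
  have hh := contDiffOn_yOutput hφsymm
  have hπ := continuousAt_outputJet φ.open_target hf hh hξ₀
  obtain ⟨g, hg⟩ := exists_isPartialParam hf hφ hφsymm hT hξ₀ hreg B.nb le_rfl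
  have hsrc : g (outputJet f (yOutput φ) ξ₀) ∈ φ.source := by
    rw [hg.base]; exact φ.map_target hξ₀
  obtain ⟨M, hM, hMo, hM₀⟩ := eventually_nhds_iff.1 (hg.smooth.eventually.and (hg.solves.and
    (hg.smooth.continuousAt.eventually (φ.open_source.mem_nhds hsrc))))
  have hp : IsParam φ T M g := ⟨hMo, fun Y hY => (hM Y hY).1, fun Y hY => (hM Y hY).2.2,
    fun Y _ => hg.inl Y, fun Y hY i => (hM Y hY).2.1 i i.2⟩
  -- Near the base sequence `φ ∘ g` factors as `G ∘ L`, and `L` sees only the terms up to some `r`.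
  -- This is the order of the parameterization, with `F = G ∘ L ∘ extendByZero r`.
  obtain ⟨E, _, _, L, G, O, hO, hO₀, hG, hGL⟩ := hp.cylSmoothAt_comp hφ hM₀
  obtain ⟨r, hr⟩ := exists_clm_apply_eq_extendByZero L
  obtain ⟨N, hN, hNo, hN₀⟩ := eventually_nhds_iff.1 (hg.agrees.and
    ((continuous_base.continuousAt.eventually (φ.open_target.mem_nhds hξ₀)).and
    ((hπ.eventually (hMo.mem_nhds hM₀)).and
    (hπ.eventually ((hO.preimage L.continuous).mem_nhds hO₀)))))
  have hgN : ∀ ξ ∈ N, g (outputJet f (yOutput φ) ξ) = φ.symm (Jet.base ξ) := fun ξ hξ =>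
    -- At stage `B.nb` the bound on the block number excludes nothing: all of `z` is recovered.
    funext fun κ => (hN ξ hξ).1 κ (Nat.lt_succ_iff.1 κ.1.2)
  have hlift : ∀ ξ ∈ N, jetOfOutput φ g (outputJet f (yOutput φ) ξ) = ξ := by
    intro ξ hξ
    refine Prod.ext ?_ (funext fun k => funext fun j => ?_)
    · change (φ (g (outputJet f (yOutput φ) ξ))).1 = _
      rw [hgN ξ hξ, φ.right_inv (hN ξ hξ).2.1]
      rfl
    · exact hp.inputDeriv_outputJet hf hφ hφsymm hNo (fun ξ hξ => (hN ξ hξ).2.1)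
        (fun ξ hξ => (hN ξ hξ).2.2.1) hgN k j hξ
  refine ⟨hcard, ⟨φ.target, φ.open_target, hξ₀, hh⟩, N, hNo, hN₀, fun ξ hξ => ?_, r,
    (L.comp (extendByZero r)) ⁻¹' O, fun y => G (L.comp (extendByZero r) y),
    hO.preimage (L.comp (extendByZero r)).continuous,
    hG.comp (L.comp (extendByZero r)).contDiff.contDiffOn fun y hy => hy, fun ξ hξ => ?_⟩
  · rw [← hlift ξ hξ]
    exact hp.differentiallyIndependentAt hf hφ hφsymm hT (hN ξ hξ).2.2.1
  · have h1 : L.comp (extendByZero r) (fun (k : Fin (r + 1)) (i : B.YIndex) =>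
        outputDeriv f (yOutput φ) k i ξ) = L (outputJet f (yOutput φ) ξ) :=
      (hr (outputJet f (yOutput φ) ξ)).symm
    have h2 : L (outputJet f (yOutput φ) ξ) ∈ O := (hN ξ hξ).2.2.2
    refine ⟨by rw [mem_preimage, h1]; exact h2, ?_⟩
    refine (congrArg G h1).trans ((hGL _ h2).symm.trans ?_)
    change φ (g (outputJet f (yOutput φ) ξ)) = _
    rw [hgN ξ hξ, φ.right_inv (hN ξ hξ).2.1]

theorem card_yIndex (B : BlockPartition) :
    Fintype.card B.YIndex = ∑ i : Fin B.nb, B.ny i.castSucc := by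
  simp [Fin.sum_univ_castSucc, B.ny_last]

end Lift

end ControlFlat

end

theorem mainTheorem2 {nx nu : ℕ}
    -- a smooth control system on an open set of the `(x,u)`-space
    (Ω : Set (ControlFlat.StateInput nx nu)) (hΩ : IsOpen Ω)
    (f : ControlFlat.StateInput nx nu → Fin nx → ℝ) (hf : ContDiffOn ℝ ∞ f Ω)
    -- the jet near which we work
    (ξ₀ : ControlFlat.Jet nx nu)
    -- the blocks of `z`
    (B : ControlFlat.BlockPartition)
    (hnz : ∑ i, B.nz i = nx + nu)
    (hny : ∑ i : Fin B.nb, B.ny i.castSucc = nu)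
    -- the local diffeomorphism `(x,u) = φ(z)`
    (φ : OpenPartialHomeomorph B.Coord (ControlFlat.StateInput nx nu))
    (hφ : ContDiffOn ℝ ∞ φ φ.source) (hφsymm : ContDiffOn ℝ ∞ φ.symm φ.target)
    (hφΩ : φ.target ⊆ Ω) (hξ₀ : ControlFlat.Jet.base ξ₀ ∈ φ.target)
    -- the implicit triangular form, regular at the values of `z` and `ż` given by `ξ₀`
    (T : ControlFlat.TriangularEquations B φ.source)
    (hT : ControlFlat.Represents T φ f)
    (hreg : T.RegularAt (φ.symm (ControlFlat.Jet.base ξ₀))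
      (fderiv ℝ φ.symm (ControlFlat.Jet.base ξ₀) (f (ControlFlat.Jet.base ξ₀), ξ₀.2 1))) :
    ControlFlat.IsOneFlatAt f ξ₀ ∧
      ControlFlat.IsFlatOutputAt f (fun p => B.yPart (φ.symm p)) ξ₀ := by
  have hf' : ContDiffOn ℝ ∞ f φ.target := hf.mono hφΩ
  have hcard : Fintype.card B.YIndex = nu := (ControlFlat.card_yIndex B).trans hny
  have h := ControlFlat.isFlatOutputAt_yOutput hcard hf' hφ hφsymm hT hξ₀ hreg
  exact ⟨⟨_, h.reindex (Fintype.equivFinOfCardEq hcard).symm⟩, h⟩
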